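/- Let $A\in\mathbb{R}^{n\times n}$, $B\in\mathbb{R}^{n\times m}$, and consider the linear system with noisy state measurements $$x_{k+1}=Ax_k+Bu_k+w_k,\qquad y_k=x_k+v_k,\qquad k\ge 0,$$ where $w_k\sim\mathcal N(0,\Sigma_w)$ and $v_k\sim\mathcal N(0,\Sigma_v)$ with $\Sigma_w,\Sigma_v\succeq 0$, and all the random vectors $w_0,w_1,\dots,v_0,v_1,\dots$ are mutually independent. Let $H_k\in\mathbb{R}^{p\times n}$ and $h_k\in\mathbb{R}^p$; the state $x_k$ is called safe if $H_kx_k\le h_k$ componentwise. For $t\ge 2$ put $N=\lfloor t/2\rfloor$ and $$\widehat\Sigma_w=\frac1N\sum_{k=0}^{N-1}(y_{2k+1}-\widehat y_{2k+1})(y_{2k+1}-\widehat y_{2k+1})^\top,\qquad \widehat y_{2k+1}=Ay_{2k}+Bu_{2k}.$$ Let $\delta>0$, let $t>2n+3$ (so that $N-n-1\geq 1$), let $\bar u_t\in\mathbb{R}^m$ be a (possibly random) nominal input, let $\mathbf d:\mathbb{R}^m\times\mathbb{R}^m\to\mathbb{R}$ be a function measuring distance, and consider the robust program $$\min_{u\in\mathbb{R}^m}\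 \mathbf d(u,\bar u_t)\quad\text{s.t.}\quad H_{t+1}(Ay_t+Bu+\check w)\le h_{t+1}\quad\text{for all }\check w\in\mathbb{R}^n\text{ with }\ \check w^\top\widehat\Sigma_w^{-1}\check w\le\frac{Nn}{(N-n-1)\,\delta},$$ where, if $\widehat\Sigma_w$ is singular, the constraint is imposed for all $\check w\in\mathbb{R}^n$. Suppose that, almost surely, whenever this program is feasible, the implemented input $u_t$ is a minimizer of it. Then: 1. if the program is feasible almost surely, then $\mathbb{P}\{H_{t+1}x_{t+1}\le h_{t+1}\}\ge 1-\delta$; 2. without assuming feasibility, the probability that the program is infeasible or $x_{t+1}$ is safe is at least $1-\delta$. -/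

import Mathlib

open scoped Matrix

namespace NoisySafeLearning

noncomputable section

/-- Empirical covariance at time `t` along a trajectory of measurements `y` and inputs `u`, built
from every other sample:
`Σ̂ = (1 / ⌊t/2⌋) ∑_{k < ⌊t/2⌋} (y_{2k+1} - ŷ_{2k+1}) (y_{2k+1} - ŷ_{2k+1})ᵀ`,
where `ŷ_{2k+1} = A y_{2k} + B u_{2k}` (here `t / 2` is division in `ℕ`). -/
def empiricalCov {n m : ℕ} (A : Matrix (Fin n) (Fin n) ℝ) (B : Matrix (Fin n) (Fin m) ℝ)
    (y : ℕ → Fin n → ℝ) (u : ℕ → Fin m → ℝ) (t : ℕ) : Matrix (Fin n) (Fin n) ℝ :=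
  ((t / 2 : ℕ) : ℝ)⁻¹ • ∑ k ∈ Finset.range (t / 2),
    Matrix.vecMulVec
      (y (2 * k + 1) - (A *ᵥ y (2 * k) + B *ᵥ u (2 * k)))
      (y (2 * k + 1) - (A *ᵥ y (2 * k) + B *ᵥ u (2 * k)))

/-- The bound `⌊t/2⌋ n / ((⌊t/2⌋ - n - 1) δ)` in the uncertainty ellipsoid. -/
def ellipsoidBound (n t : ℕ) (δ : ℝ) : ℝ :=
  (((t / 2 : ℕ) : ℝ) * n) / ((((t / 2 : ℕ) : ℝ) - n - 1) * δ)

/-- Feasible set of the robust program: all inputs `u` such that `H (A y + B u + w) ≤ h`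
(componentwise) for every `w` with `wᵀ S⁻¹ w ≤ c`. If `S` is singular, `S⁻¹` is the zero matrix in
Mathlib, so that the constraint is then required for every `w` (when `0 ≤ c`). -/
def feasibleSet {n m p : ℕ} (A : Matrix (Fin n) (Fin n) ℝ) (B : Matrix (Fin n) (Fin m) ℝ)
    (H : Matrix (Fin p) (Fin n) ℝ) (h : Fin p → ℝ) (y : Fin n → ℝ)
    (S : Matrix (Fin n) (Fin n) ℝ) (c : ℝ) : Set (Fin m → ℝ) :=
  {u | ∀ w : Fin n → ℝ, w ⬝ᵥ (S⁻¹ *ᵥ w) ≤ c → H *ᵥ (A *ᵥ y + B *ᵥ u + w) ≤ h}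

/-- `u` is a minimizer of `d(·, ubar)` over the set `F`. -/
def IsArgmin {m : ℕ} (d : (Fin m → ℝ) → (Fin m → ℝ) → ℝ) (ubar : Fin m → ℝ)
    (F : Set (Fin m → ℝ)) (u : Fin m → ℝ) : Prop :=
  u ∈ F ∧ ∀ u' ∈ F, d u ubar ≤ d u' ubar

end

end NoisySafeLearning

/-!
Let `S = ∑ₖ eₖ eₖᵀ` be the scatter matrix of `N` independent centred Gaussian vectors `eₖ` with
common covariance `T`, and `R = (ε 1 + S)⁻¹`. Gaussian integration by parts in each `eₖ`, applied to
`∑ₖ eₖᵀ R eₖ = tr (R S) ≤ n`, gives `(N - n - 1) E tr (R T) ≤ n`. The prediction error `z` made at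
time `t` is a function of `w_t` and `v_t`, the innovation `eₖ = y_{2k+1} - ŷ_{2k+1}` a function of
`w_{2k}`, `v_{2k}` and `v_{2k+1}`; as these noises are distinct, `z` and the `eₖ` are independent,
and the covariance of `eₖ` exceeds that of `z` by `Σ_v`. Hence `E zᵀ R z ≤ n / (N - n - 1)`. Letting
`ε → 0` with Fatou's lemma, Markov's inequality bounds by `δ` the probability that `z` leaves the
ellipsoid against which the robust constraint guards.
-/

namespace NoisySafeLearning

open MeasureTheory ProbabilityTheory Matrix Filter Topology
open scoped NNReal

theorem hasDerivAt_gaussianPDFReal_zero (σ : ℝ≥0) (s : ℝ) :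
    HasDerivAt (gaussianPDFReal 0 σ) (-(s / σ) * gaussianPDFReal 0 σ s) s := by
  have hexponent : HasDerivAt (fun s : ℝ => -(s - 0) ^ 2 / (2 * (σ : ℝ))) (-(s / σ)) s := by
    convert! (((hasDerivAt_id s).sub_const 0).pow 2).neg.div_const (2 * (σ : ℝ)) using 1
    simp only [id_eq, sub_zero, Nat.cast_ofNat]
    ring
  rw [gaussianPDFReal_def]
  convert! hexponent.exp.const_mul (√(2 * Real.pi * σ))⁻¹ using 1
  ring

theorem integrable_gaussianReal_iff {μ : ℝ} {σ : ℝ≥0} (hσ : σ ≠ 0) {f : ℝ → ℝ} :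
    Integrable f (gaussianReal μ σ) ↔ Integrable fun s => f s * gaussianPDFReal μ σ s := by
  rw [gaussianReal_of_var_ne_zero _ hσ,
    integrable_withDensity_iff (measurable_gaussianPDF μ σ) (by simp [gaussianPDF])]
  simp [gaussianPDF, gaussianPDFReal_nonneg]

theorem integral_id_mul_gaussianReal {σ : ℝ≥0} (hσ : σ ≠ 0) {f f' : ℝ → ℝ}
    (hf : ∀ s, HasDerivAt f (f' s) s) (hi : Integrable f (gaussianReal 0 σ))
    (hsi : Integrable (fun s => s * f s) (gaussianReal 0 σ))
    (hi' : Integrable f' (gaussianReal 0 σ)) :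
    ∫ s, s * f s ∂gaussianReal 0 σ = σ * ∫ s, f' s ∂gaussianReal 0 σ := by
  have hσ' : (σ : ℝ) ≠ 0 := NNReal.coe_ne_zero.2 hσ
  rw [integrable_gaussianReal_iff hσ] at hi hsi hi'
  have hparts := integral_mul_deriv_eq_deriv_mul_of_integrable (fun s _ => hf s)
    (fun s _ => hasDerivAt_gaussianPDFReal_zero σ s)
    ((hsi.const_mul (-(σ : ℝ)⁻¹)).congr (ae_of_all _ fun s => by simp only [Pi.mul_apply]; ring))
    hi' hi
  have hleft : ∫ s, f s * (-(s / σ) * gaussianPDFReal 0 σ s) =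
      -((σ : ℝ)⁻¹ * ∫ s, gaussianPDFReal 0 σ s * (s * f s)) := by
    rw [← integral_const_mul, ← integral_neg]
    exact integral_congr_ae (ae_of_all _ fun s => by ring)
  simp only [integral_gaussianReal_eq_integral_smul hσ, smul_eq_mul]
  rw [hleft, neg_inj, inv_mul_eq_iff_eq_mul₀ hσ'] at hparts
  simpa only [mul_comm (f' _)] using hparts

theorem integral_fst_mul_gaussianReal_prod {σ : ℝ≥0} (hσ : σ ≠ 0) {α : Type*} [MeasurableSpace α]
    {ν : Measure α} [SFinite ν] {G G' : ℝ × α → ℝ}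
    (hG : ∀ s a, HasDerivAt (fun r => G (r, a)) (G' (s, a)) s)
    (hi : Integrable G ((gaussianReal 0 σ).prod ν))
    (hsi : Integrable (fun q => q.1 * G q) ((gaussianReal 0 σ).prod ν))
    (hi' : Integrable G' ((gaussianReal 0 σ).prod ν)) :
    ∫ q, q.1 * G q ∂(gaussianReal 0 σ).prod ν = σ * ∫ q, G' q ∂(gaussianReal 0 σ).prod ν := by
  rw [integral_prod_symm _ hsi, integral_prod_symm _ hi', ← integral_const_mul]
  refine integral_congr_ae ?_
  filter_upwards [hi.prod_left_ae, hsi.prod_left_ae, hi'.prod_left_ae] with a hia hsia hia'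
  exact integral_id_mul_gaussianReal hσ (fun s => hG s a) hia hsia hia'

section GaussianIntegrationByParts
variable {Ω E : Type*} [MeasurableSpace Ω] {P : Measure Ω} [NormedAddCommGroup E]
  [NormedSpace ℝ E] [CompleteSpace E] [SecondCountableTopology E] [MeasurableSpace E] [BorelSpace E]
  {X : Ω → E} {L : StrongDual ℝ E} {v : E}

theorem indepFun_dual_sub_smul (hX : HasGaussianLaw X P)
    (hv : ∀ L' : StrongDual ℝ E, cov[L ∘ X, L' ∘ X; P] = L' v) (hLv : L v ≠ 0) :
    IndepFun (L ∘ X) (fun ω => X ω - (L (X ω) / L v) • v) P := by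
  have := hX.isProbabilityMeasure
  have hjoint : HasGaussianLaw (fun ω => (L (X ω), X ω - (L (X ω) / L v) • v)) P := by
    convert! hX.map_fun (L.prod (.id ℝ E - ((L v)⁻¹ • L).smulRight v)) using 2 with _
    simp [div_eq_inv_mul]
  have hL2 (L' : StrongDual ℝ E) : MemLp (L' ∘ X) 2 P := (hX.map L').memLp_two
  refine hjoint.indepFun_of_covariance_strongDual fun L₁ L₂ => ?_
  have hL₁ : L₁ ∘ L ∘ X = fun ω => L₁ 1 * (L ∘ X) ω := by
    ext ω
    rw [Function.comp_apply, Function.comp_apply, mul_comm, ← smul_eq_mul, ← map_smul, smul_eq_mul,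
      mul_one]
  have hL₂ : (L₂ ∘ fun ω => X ω - (L (X ω) / L v) • v) =
      L₂ ∘ X - fun ω => L₂ v / L v * (L ∘ X) ω := by
    ext ω
    simp only [Function.comp_apply, map_sub, map_smul, smul_eq_mul, Pi.sub_apply]
    ring
  change cov[L₁ ∘ L ∘ X, _; P] = 0
  rw [hL₁, hL₂, covariance_const_mul_left,
    covariance_sub_right (hL2 L) (hL2 L₂) ((hL2 L).const_mul _), covariance_const_mul_right, hv, hv]
  field_simp
  ring

theorem map_dual_prodMk_sub_smul (hX : HasGaussianLaw X P) (hX0 : ∫ ω, L (X ω) ∂P = 0)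
    (hv : ∀ L' : StrongDual ℝ E, cov[L ∘ X, L' ∘ X; P] = L' v) (hLv : L v ≠ 0) :
    P.map (fun ω => (L (X ω), X ω - (L (X ω) / L v) • v)) =
      (gaussianReal 0 (L v).toNNReal).prod (P.map fun ω => X ω - (L (X ω) / L v) • v) := by
  have := hX.isProbabilityMeasure
  have hXm := hX.aemeasurable
  have hlaw : P.map (L ∘ X) = gaussianReal 0 (L v).toNNReal := by
    rw [(hX.map L).map_eq_gaussianReal, ← hv L, covariance_self (hX.map L).aemeasurable]
    exact congrArg (gaussianReal · _) hX0
  rw [← hlaw]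
  exact (indepFun_iff_map_prod_eq_prod_map_map (by fun_prop) (by fun_prop)).1
    (indepFun_dual_sub_smul hX hv hLv)

-- `X` is the sum of `(L X / L v) • v` and a part independent of `L X`; with the latter fixed, `X`
-- runs along a line of direction `v`, on which the one-dimensional identity applies.
theorem integral_dual_mul_eq_integral_lineDeriv_of_ne_zero (hX : HasGaussianLaw X P)
    (hX0 : ∫ ω, L (X ω) ∂P = 0) (hv : ∀ L' : StrongDual ℝ E, cov[L ∘ X, L' ∘ X; P] = L' v)
    (hLv : L v ≠ 0) {F F' : E → ℝ} (hF : ∀ x, HasLineDerivAt ℝ F (F' x) x v)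
    (hm : Measurable F) (hm' : Measurable F') (hi : Integrable (fun ω => F (X ω)) P)
    (hLi : Integrable (fun ω => L (X ω) * F (X ω)) P)
    (hi' : Integrable (fun ω => F' (X ω)) P) :
    ∫ ω, L (X ω) * F (X ω) ∂P = ∫ ω, F' (X ω) ∂P := by
  have := hX.isProbabilityMeasure
  have hXm := hX.aemeasurable
  have hσ : ((L v).toNNReal : ℝ) = L v := Real.coe_toNNReal _ <| by
    rw [← hv, covariance_self (hX.map L).aemeasurable]
    exact variance_nonneg _ _
  have hσ0 : (L v).toNNReal ≠ 0 := by rwa [← NNReal.coe_ne_zero, hσ]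
  let Y : Ω → ℝ × E := fun ω => (L (X ω), X ω - (L (X ω) / L v) • v)
  have hYm : AEMeasurable Y P := by fun_prop
  let Φ : ℝ × E → E := fun q => q.2 + (q.1 / L v) • v
  have hΦ : Measurable Φ := by fun_prop
  have hΦY (ω : Ω) : Φ (Y ω) = X ω := sub_add_cancel _ _
  have hderiv (s : ℝ) (y : E) :
      HasDerivAt (fun r => F (Φ (r, y))) ((L v)⁻¹ * F' (Φ (s, y))) s := by
    have hinner : HasDerivAt (fun r : ℝ => (r - s) / L v) (1 / L v) s :=
      ((hasDerivAt_id s).sub_const s).div_const _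
    convert! (hF (Φ (s, y))).comp_of_eq s hinner (by simp) using 1
    · ext r
      simp only [Φ, Function.comp_apply]
      congr 1
      module
    · ring
  have hFm : Measurable fun q => F (Φ q) := hm.comp hΦ
  have hFm' : Measurable fun q => F' (Φ q) := hm'.comp hΦ
  have hmap := map_dual_prodMk_sub_smul hX hX0 hv hLv
  have transfer {G : ℝ × E → ℝ} (hG : Measurable G) (hGY : Integrable (fun ω => G (Y ω)) P) :
      Integrable G (P.map Y) := (integrable_map_measure hG.aestronglyMeasurable hYm).2 hGY
  have hstein := integral_fst_mul_gaussianReal_prod hσ0 hderiv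
    (hmap ▸ transfer hFm (by simpa only [hΦY] using hi))
    (hmap ▸ transfer (measurable_fst.mul hFm) (by simpa only [Y, hΦY] using hLi))
    (hmap ▸ transfer (hFm'.const_mul _) (by simpa only [hΦY] using hi'.const_mul _))
  rw [← hmap, integral_const_mul, hσ, mul_inv_cancel_left₀ hLv,
    integral_map hYm (by fun_prop),
    integral_map hYm hFm'.aestronglyMeasurable] at hstein
  simpa only [hΦY] using hstein

theorem integral_dual_mul_eq_integral_lineDeriv (hX : HasGaussianLaw X P)
    (hX0 : ∫ ω, L (X ω) ∂P = 0) (hv : ∀ L' : StrongDual ℝ E, cov[L ∘ X, L' ∘ X; P] = L' v)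
    {F F' : E → ℝ} (hF : ∀ x, HasLineDerivAt ℝ F (F' x) x v)
    (hm : Measurable F) (hm' : Measurable F') (hi : Integrable (fun ω => F (X ω)) P)
    (hLi : Integrable (fun ω => L (X ω) * F (X ω)) P)
    (hi' : Integrable (fun ω => F' (X ω)) P) :
    ∫ ω, L (X ω) * F (X ω) ∂P = ∫ ω, F' (X ω) ∂P := by
  rcases ne_or_eq (L v) 0 with hLv | hLv
  · exact integral_dual_mul_eq_integral_lineDeriv_of_ne_zero hX hX0 hv hLv hF hm hm' hi hLi hi'
  -- `L v` is the variance of `L X`: when it vanishes, so do `L X` and, with its covariances, `v`.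
  have := hX.isProbabilityMeasure
  have hL : ∀ᵐ ω ∂P, L (X ω) = 0 := by
    refine (ae_eq_integral_of_variance_eq_zero (hX.map L).memLp_two ?_).mono fun ω hω =>
      hω.trans hX0
    rw [← covariance_self (hX.map L).aemeasurable, hv, hLv]
  have hv0 : v = 0 := by
    refine SeparatingDual.eq_zero_of_forall_dual_eq_zero (R := ℝ) fun L' => ?_
    rw [← hv]
    refine integral_eq_zero_of_ae (hL.mono fun ω hω => ?_)
    simp [hω, hX0]
  have hF' (x : E) : F' x = 0 := (hv0 ▸ hF x).unique hasLineDerivAt_zero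
  simp only [hF', integral_zero]
  exact integral_eq_zero_of_ae (hL.mono fun ω hω => by simp [hω])

end GaussianIntegrationByParts

section MatrixInverse
open scoped Matrix.Norms.Operator
variable {ι : Type*} [Fintype ι] [DecidableEq ι]

theorem hasDerivAt_matrix_inv {C : ℝ → Matrix ι ι ℝ} {C' : Matrix ι ι ℝ} {s : ℝ}
    (hC : HasDerivAt C C' s) (hs : IsUnit (C s)) :
    HasDerivAt (fun r => (C r)⁻¹) (-((C s)⁻¹ * C' * (C s)⁻¹)) s := by
  obtain ⟨U, hU⟩ := hs
  simp only [nonsing_inv_eq_ringInverse, ← hU, Ring.inverse_unit]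
  exact (hasFDerivAt_ringInverse (𝕜 := ℝ) U).comp_hasDerivAt_of_eq s hC hU

theorem hasDerivAt_matrix_inv_mulVec_apply {C : ℝ → Matrix ι ι ℝ} {C' : Matrix ι ι ℝ}
    {b : ℝ → ι → ℝ} {b' : ι → ℝ} {s : ℝ} (hC : HasDerivAt C C' s) (hs : IsUnit (C s))
    (hb : HasDerivAt b b' s) (i : ι) :
    HasDerivAt (fun r => ((C r)⁻¹ *ᵥ b r) i)
      (((C s)⁻¹ *ᵥ b' - (C s)⁻¹ *ᵥ C' *ᵥ (C s)⁻¹ *ᵥ b s) i) s := by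
  have hentry (j : ι) : HasDerivAt (fun r => (C r)⁻¹ i j) (-((C s)⁻¹ * C' * (C s)⁻¹) i j) s :=
    (LinearMap.toContinuousLinearMap (entryLinearMap ℝ ℝ i j)).hasFDerivAt.comp_hasDerivAt s
      (hasDerivAt_matrix_inv hC hs)
  convert! HasDerivAt.fun_sum (u := Finset.univ) fun j _ =>
    (hentry j).mul (hasDerivAt_pi.1 hb j) using 1
  rw [Finset.sum_add_distrib, mulVec_mulVec, mulVec_mulVec, Pi.sub_apply, sub_eq_neg_add]
  simp only [mulVec, dotProduct, neg_mul, Finset.sum_neg_distrib]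

end MatrixInverse

section QuadraticForm
variable {ι : Type*} [Fintype ι] {Q S : Matrix ι ι ℝ}

theorem dotProduct_mulVec_comm_of_isHermitian (hQ : Q.IsHermitian) (a b : ι → ℝ) :
    a ⬝ᵥ Q *ᵥ b = b ⬝ᵥ Q *ᵥ a := by
  have hT : Qᵀ = Q := by simpa using hQ.eq
  rw [dotProduct_mulVec, ← mulVec_transpose, hT, dotProduct_comm]

theorem two_mul_abs_dotProduct_mulVec_le (hQ : Q.PosSemidef) (a b : ι → ℝ) :
    2 * |a ⬝ᵥ Q *ᵥ b| ≤ a ⬝ᵥ Q *ᵥ a + b ⬝ᵥ Q *ᵥ b := by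
  have hadd : 0 ≤ (a + b) ⬝ᵥ Q *ᵥ (a + b) := by simpa using hQ.dotProduct_mulVec_nonneg (a + b)
  have hsub : 0 ≤ (a - b) ⬝ᵥ Q *ᵥ (a - b) := by simpa using hQ.dotProduct_mulVec_nonneg (a - b)
  simp only [mulVec_add, mulVec_sub, add_dotProduct, sub_dotProduct, dotProduct_add,
    dotProduct_sub, dotProduct_mulVec_comm_of_isHermitian hQ.isHermitian b a] at hadd hsub
  rcases abs_cases (a ⬝ᵥ Q *ᵥ b) with ⟨h, _⟩ | ⟨h, _⟩ <;> rw [h] <;> linarith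

theorem dotProduct_mulVec_eq_trace (Q : Matrix ι ι ℝ) (a b : ι → ℝ) :
    a ⬝ᵥ Q *ᵥ b = (Q * vecMulVec b a).trace := by
  rw [mul_vecMulVec, trace_vecMulVec, dotProduct_comm]

theorem dotProduct_mulVec_eq_sum_sum (Q : Matrix ι ι ℝ) (a : ι → ℝ) :
    a ⬝ᵥ Q *ᵥ a = ∑ i, ∑ j, a j * a i * Q i j := by
  simp only [dotProduct, mulVec, Finset.mul_sum]
  exact Finset.sum_congr rfl fun i _ => Finset.sum_congr rfl fun j _ => by ring

theorem trace_mul_nonneg (hQ : Q.PosSemidef) (hS : S.PosSemidef) : 0 ≤ (Q * S).trace := by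
  obtain ⟨r, v, rfl⟩ := posSemidef_iff_eq_sum_vecMulVec.1 hS
  rw [Matrix.mul_sum, trace_sum]
  refine Finset.sum_nonneg fun i _ => ?_
  rw [← dotProduct_mulVec_eq_trace]
  exact hQ.dotProduct_mulVec_nonneg (v i)

theorem trace_mul_transpose_eq_sum (Q S : Matrix ι ι ℝ) :
    (Q * Sᵀ).trace = ∑ i, (Q *ᵥ S i) i := rfl

end QuadraticForm

section Resolvent
variable {ι K : Type*} [Fintype K]

/-- The unnormalised empirical second moment `∑ k, e k (e k)ᵀ` of a finite family of vectors. -/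
def scatter (e : K → ι → ℝ) : Matrix ι ι ℝ := ∑ k, vecMulVec (e k) (e k)

theorem continuous_scatter : Continuous (scatter : (K → ι → ℝ) → Matrix ι ι ℝ) :=
  continuous_finsetSum _ fun k _ => (continuous_apply k).matrix_vecMulVec (continuous_apply k)

theorem scatter_add_smul_single [DecidableEq K] (e : K → ι → ℝ) (k : K) (v : ι → ℝ) (s : ℝ) :
    scatter (e + s • (Pi.single k v : K → ι → ℝ)) =
      scatter e + s • (vecMulVec v (e k) + vecMulVec (e k) v) + s ^ 2 • vecMulVec v v := by
  rw [scatter, scatter, ← Finset.sum_erase_add _ _ (Finset.mem_univ k),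
    ← Finset.sum_erase_add (a := k) _ (fun l => vecMulVec (e l) (e l)) (Finset.mem_univ k)]
  have hne (l : K) (hl : l ∈ Finset.univ.erase k) :
      (e + s • (Pi.single k v : K → ι → ℝ)) l = e l := by
    simp [Finset.ne_of_mem_erase hl]
  rw [Finset.sum_congr rfl fun l hl => by rw [hne l hl]]
  simp only [Pi.add_apply, Pi.smul_apply, Pi.single_eq_same, vecMulVec_add, add_vecMulVec,
    vecMulVec_smul, smul_vecMulVec]
  module

theorem posSemidef_scatter [Finite ι] (e : K → ι → ℝ) : (scatter e).PosSemidef :=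
  posSemidef_sum _ fun k _ => posSemidef_vecMulVec_self_star (e k)

variable [DecidableEq ι] {ε : ℝ}

theorem posDef_smul_one_add_scatter [Finite ι] (hε : 0 < ε) (e : K → ι → ℝ) :
    (ε • (1 : Matrix ι ι ℝ) + scatter e).PosDef :=
  (PosDef.one.smul hε).add_posSemidef (posSemidef_scatter e)

variable [Fintype ι]

/-- The regularised inverse `(ε + ∑ k, e k (e k)ᵀ)⁻¹` of the scatter matrix. -/
noncomputable def resolvent (ε : ℝ) (e : K → ι → ℝ) : Matrix ι ι ℝ :=
  (ε • (1 : Matrix ι ι ℝ) + scatter e)⁻¹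

theorem posDef_resolvent (hε : 0 < ε) (e : K → ι → ℝ) : (resolvent ε e).PosDef :=
  (posDef_smul_one_add_scatter hε e).inv

theorem continuous_resolvent (hε : 0 < ε) :
    Continuous (resolvent ε : (K → ι → ℝ) → Matrix ι ι ℝ) := by
  refine continuous_iff_continuousAt.2 fun e => ContinuousAt.comp (f := fun e => _ + scatter e)
    (continuousAt_matrix_inv _ ?_) (continuous_const.add continuous_scatter).continuousAt
  rw [Ring.inverse_eq_inv']
  exact continuousAt_inv₀ (posDef_smul_one_add_scatter hε e).det_pos.ne'

theorem resolvent_mul_scatter (hε : 0 < ε) (e : K → ι → ℝ) :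
    resolvent ε e * scatter e = 1 - ε • resolvent ε e := by
  have h : resolvent ε e * (ε • (1 : Matrix ι ι ℝ) + scatter e) = 1 :=
    nonsing_inv_mul _ (posDef_smul_one_add_scatter hε e).det_pos.ne'.isUnit
  rw [Matrix.mul_add, Matrix.mul_smul, Matrix.mul_one] at h
  rw [← h, add_sub_cancel_left]

theorem dotProduct_resolvent_nonneg (hε : 0 < ε) (e : K → ι → ℝ) (a : ι → ℝ) :
    0 ≤ a ⬝ᵥ resolvent ε e *ᵥ a := by
  simpa using (posDef_resolvent hε e).posSemidef.dotProduct_mulVec_nonneg a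

theorem dotProduct_resolvent_le (hε : 0 < ε) (e : K → ι → ℝ) (a : ι → ℝ) :
    a ⬝ᵥ resolvent ε e *ᵥ a ≤ ε⁻¹ * (a ⬝ᵥ a) := by
  set b := resolvent ε e *ᵥ a with hb
  have hab : ε • b + scatter e *ᵥ b = a := by
    have : (ε • (1 : Matrix ι ι ℝ) + scatter e) *ᵥ b = a := by
      rw [hb, mulVec_mulVec, resolvent,
        mul_nonsing_inv _ (posDef_smul_one_add_scatter hε e).det_pos.ne'.isUnit, one_mulVec]
    rwa [add_mulVec, smul_mulVec, one_mulVec] at this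
  have hεb : ε * (b ⬝ᵥ b) ≤ a ⬝ᵥ b := by
    have hMb : 0 ≤ b ⬝ᵥ scatter e *ᵥ b := by
      simpa using (posSemidef_scatter e).dotProduct_mulVec_nonneg b
    calc ε * (b ⬝ᵥ b) ≤ ε * (b ⬝ᵥ b) + b ⬝ᵥ scatter e *ᵥ b := le_add_of_nonneg_right hMb
      _ = b ⬝ᵥ (ε • b + scatter e *ᵥ b) := by rw [dotProduct_add, dotProduct_smul, smul_eq_mul]
      _ = a ⬝ᵥ b := by rw [hab, dotProduct_comm]
  have hsq : 0 ≤ (a - ε • b) ⬝ᵥ (a - ε • b) := by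
    simpa using dotProduct_star_self_nonneg (a - ε • b)
  simp only [sub_dotProduct, dotProduct_sub, dotProduct_smul, smul_dotProduct, smul_eq_mul,
    dotProduct_comm b a] at hsq
  rw [← div_eq_inv_mul, le_div_iff₀ hε]
  nlinarith

/-- The regularised leverage score `(e k)ᵀ (ε + ∑ l, e l (e l)ᵀ)⁻¹ e k` of the `k`-th vector. -/
noncomputable def leverage (ε : ℝ) (e : K → ι → ℝ) (k : K) : ℝ := e k ⬝ᵥ resolvent ε e *ᵥ e k

theorem sum_leverage_le_card (hε : 0 < ε) (e : K → ι → ℝ) :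
    ∑ k, leverage ε e k ≤ Fintype.card ι := by
  have hsum : ∑ k, leverage ε e k = (resolvent ε e * scatter e).trace := by
    simp only [leverage, dotProduct_mulVec_eq_trace, scatter, Matrix.mul_sum, trace_sum]
  have htrace := (posDef_resolvent hε e).posSemidef.trace_nonneg
  rw [hsum, resolvent_mul_scatter hε, trace_sub, trace_one, trace_smul, smul_eq_mul]
  exact sub_le_self _ (mul_nonneg hε.le htrace)

theorem leverage_nonneg (hε : 0 < ε) (e : K → ι → ℝ) (k : K) : 0 ≤ leverage ε e k :=
  dotProduct_resolvent_nonneg hε e (e k)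

theorem leverage_le_card (hε : 0 < ε) (e : K → ι → ℝ) (k : K) :
    leverage ε e k ≤ Fintype.card ι :=
  (Finset.single_le_sum (fun l _ => leverage_nonneg hε e l) (Finset.mem_univ k)).trans
    (sum_leverage_le_card hε e)

theorem abs_dotProduct_resolvent_mulVec_le (hε : 0 < ε) (e : K → ι → ℝ) (a : ι → ℝ) (k : K) :
    |a ⬝ᵥ resolvent ε e *ᵥ e k| ≤ ε⁻¹ * (a ⬝ᵥ a) + Fintype.card ι := by
  have h := two_mul_abs_dotProduct_mulVec_le (posDef_resolvent hε e).posSemidef a (e k)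
  have ha := dotProduct_resolvent_le hε e a
  have hk := leverage_le_card hε e k
  have h0 := abs_nonneg (a ⬝ᵥ resolvent ε e *ᵥ e k)
  rw [leverage] at hk
  linarith

theorem trace_resolvent_nonneg (hε : 0 < ε) (e : K → ι → ℝ) {S : Matrix ι ι ℝ}
    (hS : S.PosSemidef) : 0 ≤ (resolvent ε e * S).trace :=
  trace_mul_nonneg (posDef_resolvent hε e).posSemidef hS

theorem sum_dotProduct_mulVec_resolvent_le (hε : 0 < ε) (e : K → ι → ℝ) {S : Matrix ι ι ℝ}
    (hS : S.PosSemidef) :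
    ∑ k, (resolvent ε e *ᵥ e k) ⬝ᵥ S *ᵥ (resolvent ε e *ᵥ e k) ≤ (resolvent ε e * S).trace := by
  set R := resolvent ε e
  have hR : R.PosSemidef := (posDef_resolvent hε e).posSemidef
  have hRT : Rᵀ = R := by simpa using hR.isHermitian.eq
  have hsum : ∑ k, (R *ᵥ e k) ⬝ᵥ S *ᵥ (R *ᵥ e k) = (R * scatter e * R * S).trace := by
    simp only [dotProduct_mulVec_eq_trace, scatter, Matrix.mul_sum, Matrix.sum_mul, trace_sum]
    refine Finset.sum_congr rfl fun k _ => ?_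
    rw [trace_mul_comm S, mul_vecMulVec R, vecMulVec_mul _ _ R, ← mulVec_transpose R, hRT]
  have hRR : (R * R).PosSemidef := by
    simpa [hRT] using posSemidef_conjTranspose_mul_self R
  rw [hsum, resolvent_mul_scatter hε, Matrix.sub_mul, Matrix.one_mul, Matrix.sub_mul,
    trace_sub, Matrix.smul_mul, Matrix.smul_mul, trace_smul, smul_eq_mul]
  exact sub_le_self _ (mul_nonneg hε.le (trace_mul_nonneg hRR hS))

/-- The derivative of `e ↦ resolvent ε e *ᵥ e k` when only the vector `e k` moves, in the
direction `v`; see `hasLineDerivAt_resolvent_mulVec_apply`. -/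
noncomputable def resolventLineDeriv (ε : ℝ) (e : K → ι → ℝ) (k : K) (v : ι → ℝ) : ι → ℝ :=
  (1 - leverage ε e k) • resolvent ε e *ᵥ v -
    (v ⬝ᵥ resolvent ε e *ᵥ e k) • resolvent ε e *ᵥ e k

open scoped Matrix.Norms.Operator in
theorem hasLineDerivAt_resolvent_mulVec_apply [DecidableEq K] (hε : 0 < ε) (e : K → ι → ℝ)
    (k : K) (v : ι → ℝ) (i : ι) :
    HasLineDerivAt ℝ (fun e => (resolvent ε e *ᵥ e k) i) (resolventLineDeriv ε e k v i) e
      (Pi.single k v) := by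
  let C (s : ℝ) : Matrix ι ι ℝ := ε • 1 + scatter (e + s • (Pi.single k v : K → ι → ℝ))
  have hC0 : C 0 = ε • 1 + scatter e := by simp only [C, zero_smul, add_zero]
  have hC : HasDerivAt C (vecMulVec v (e k) + vecMulVec (e k) v) 0 := by
    have hlin := (hasDerivAt_id (0 : ℝ)).smul_const (vecMulVec v (e k) + vecMulVec (e k) v)
    have hquad := (hasDerivAt_pow 2 (0 : ℝ)).smul_const (vecMulVec v v)
    convert! ((hlin.add hquad).const_add (scatter e)).const_add (ε • (1 : Matrix ι ι ℝ)) using 1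
    · ext1 s
      simp only [C, scatter_add_smul_single, add_assoc, Pi.add_apply, id_eq]
    · simp
  have hb : HasDerivAt (fun s : ℝ => (e + s • (Pi.single k v : K → ι → ℝ)) k) v 0 := by
    simpa using ((hasDerivAt_id (0 : ℝ)).smul_const v).const_add (e k)
  have hunit : IsUnit (C 0) := hC0 ▸ (posDef_smul_one_add_scatter hε e).isUnit
  refine (hasDerivAt_matrix_inv_mulVec_apply hC hunit hb i).congr_deriv (congrFun ?_ i)
  rw [hC0, zero_smul, add_zero]
  change resolvent ε e *ᵥ v - resolvent ε e *ᵥ _ *ᵥ resolvent ε e *ᵥ e k = _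
  simp only [resolventLineDeriv, leverage, add_mulVec, vecMulVec_mulVec, mulVec_add,
    op_smul_eq_smul, mulVec_smul]
  module

theorem le_sum_resolventLineDeriv (hε : 0 < ε) (e : K → ι → ℝ) {S : Matrix ι ι ℝ}
    (hS : S.PosSemidef) :
    (Fintype.card K - Fintype.card ι - 1 : ℝ) * (resolvent ε e * S).trace ≤
      ∑ k, ∑ i, resolventLineDeriv ε e k (S i) i := by
  have hST : Sᵀ = S := by simpa using hS.isHermitian.eq
  have hk (k : K) : ∑ i, resolventLineDeriv ε e k (S i) i =
      (1 - leverage ε e k) * (resolvent ε e * S).trace -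
        (resolvent ε e *ᵥ e k) ⬝ᵥ S *ᵥ (resolvent ε e *ᵥ e k) := by
    rw [← hST, trace_mul_transpose_eq_sum, hST, Finset.mul_sum, dotProduct,
      ← Finset.sum_sub_distrib]
    exact Finset.sum_congr rfl fun i _ => sub_right_inj.2 (mul_comm _ _)
  simp only [hk, Finset.sum_sub_distrib, ← Finset.sum_mul, Finset.sum_const, Finset.card_univ,
    nsmul_eq_mul, mul_one]
  have hlev := mul_le_mul_of_nonneg_right (sum_leverage_le_card hε e)
    (trace_resolvent_nonneg hε e hS)
  linarith [sum_dotProduct_mulVec_resolvent_le hε e hS]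

end Resolvent

section ResolventBounds
variable {ι K : Type*} [Fintype K] [Fintype ι] [DecidableEq ι] {ε : ℝ}

theorem continuous_resolvent_mulVec (hε : 0 < ε) (k : K) :
    Continuous fun e : K → ι → ℝ => resolvent ε e *ᵥ e k :=
  (continuous_resolvent hε).matrix_mulVec (continuous_apply k)

theorem continuous_resolventLineDeriv (hε : 0 < ε) (k : K) (v : ι → ℝ) :
    Continuous fun e : K → ι → ℝ => resolventLineDeriv ε e k v := by
  have hR := continuous_resolvent (ι := ι) (K := K) hε
  have hRk := continuous_resolvent_mulVec (ι := ι) hε k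
  have hlev := (continuous_const (y := (1 : ℝ))).sub ((continuous_apply k).dotProduct hRk)
  exact (hlev.smul (hR.matrix_mulVec continuous_const)).sub
    ((continuous_const.dotProduct hRk).smul hRk)

theorem exists_abs_resolvent_mulVec_apply_le (hε : 0 < ε) (k : K) (i : ι) :
    ∃ C, ∀ e : K → ι → ℝ, |(resolvent ε e *ᵥ e k) i| ≤ C :=
  ⟨_, fun e => by simpa using abs_dotProduct_resolvent_mulVec_le hε e (Pi.single i 1) k⟩

theorem exists_abs_dotProduct_resolvent_le (hε : 0 < ε) (a b : ι → ℝ) :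
    ∃ C, ∀ e : K → ι → ℝ, |a ⬝ᵥ resolvent ε e *ᵥ b| ≤ C :=
  ⟨(ε⁻¹ * (a ⬝ᵥ a) + ε⁻¹ * (b ⬝ᵥ b)) / 2, fun e => by
    linarith [two_mul_abs_dotProduct_mulVec_le (posDef_resolvent hε e).posSemidef a b,
      dotProduct_resolvent_le hε e a, dotProduct_resolvent_le hε e b]⟩

theorem exists_abs_resolventLineDeriv_apply_le (hε : 0 < ε) (k : K) (v : ι → ℝ) (i : ι) :
    ∃ C, ∀ e : K → ι → ℝ, |resolventLineDeriv ε e k v i| ≤ C := by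
  obtain ⟨C₁, h₁⟩ := exists_abs_dotProduct_resolvent_le (K := K) hε (Pi.single i 1) v
  obtain ⟨C₂, h₂⟩ := exists_abs_resolvent_mulVec_apply_le (K := K) hε k i
  refine ⟨(1 + Fintype.card ι) * C₁ + (ε⁻¹ * (v ⬝ᵥ v) + Fintype.card ι) * C₂, fun e => ?_⟩
  have hlev : |1 - leverage ε e k| ≤ 1 + Fintype.card ι := abs_le.2
    ⟨by linarith [leverage_le_card hε e k], by
      linarith [leverage_nonneg hε e k, (Fintype.card ι).cast_nonneg (α := ℝ)]⟩
  simp only [single_one_dotProduct] at h₁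
  calc |resolventLineDeriv ε e k v i|
      ≤ |1 - leverage ε e k| * |(resolvent ε e *ᵥ v) i| +
          |v ⬝ᵥ resolvent ε e *ᵥ e k| * |(resolvent ε e *ᵥ e k) i| := by
        rw [← abs_mul, ← abs_mul]; exact abs_sub _ _
    _ ≤ _ := add_le_add (mul_le_mul hlev (h₁ e) (abs_nonneg _) (by positivity))
        (mul_le_mul (abs_dotProduct_resolvent_mulVec_le hε e v k) (h₂ e) (abs_nonneg _)
          ((abs_nonneg _).trans (abs_dotProduct_resolvent_mulVec_le hε e v k)))

end ResolventBounds

section ExpectationOfResolvent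
variable {Ω E : Type*} [MeasurableSpace Ω] {P : Measure Ω}

theorem integrable_comp_of_continuous_of_bounded [IsFiniteMeasure P] [TopologicalSpace E]
    [MeasurableSpace E] [OpensMeasurableSpace E] {X : Ω → E} (hX : AEMeasurable X P) {F : E → ℝ}
    (hF : Continuous F) (hb : ∃ C, ∀ x, |F x| ≤ C) : Integrable (fun ω => F (X ω)) P := by
  obtain ⟨C, hC⟩ := hb
  exact .of_bound (hF.measurable.comp_aemeasurable hX).aestronglyMeasurable C
    (ae_of_all _ fun ω => hC (X ω))

theorem integral_sum_sum {α β : Type*} [Fintype α] [Fintype β] {f : α → β → Ω → ℝ}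
    (hf : ∀ a b, Integrable (f a b) P) :
    ∫ ω, ∑ a, ∑ b, f a b ω ∂P = ∑ a, ∑ b, ∫ ω, f a b ω ∂P := by
  rw [integral_finsetSum _ fun a _ => integrable_finsetSum _ fun b _ => hf a b]
  exact Finset.sum_congr rfl fun a _ => integral_finsetSum _ fun b _ => hf a b

variable {ι : Type*}

/-- `X` is a Gaussian vector with mean zero and covariance matrix `S`, both given in coordinates:
unlike `multivariateGaussian 0 S`, this involves no choice of a norm on the codomain. -/
structure IsCenteredGaussian [Fintype ι] (X : Ω → ι → ℝ) (S : Matrix ι ι ℝ)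
    (P : Measure Ω) : Prop where
  hasGaussianLaw : HasGaussianLaw X P
  integral_apply (i : ι) : ∫ ω, X ω i ∂P = 0
  covariance_apply (i j : ι) : cov[fun ω => X ω i, fun ω => X ω j; P] = S i j

variable [Fintype ι]

theorem IsCenteredGaussian.memLp_apply {X : Ω → ι → ℝ} {S : Matrix ι ι ℝ}
    (hX : IsCenteredGaussian X S P) (i : ι) : MemLp (fun ω => X ω i) 2 P :=
  (hX.hasGaussianLaw.eval i).memLp_two

theorem IsCenteredGaussian.integral_apply_mul_apply {z : Ω → ι → ℝ} {T : Matrix ι ι ℝ}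
    (hz : IsCenteredGaussian z T P) (i j : ι) :
    ∫ ω, z ω i * z ω j ∂P = T i j := by
  have := hz.hasGaussianLaw.isProbabilityMeasure
  rw [← hz.covariance_apply i j, covariance_eq_sub (hz.memLp_apply i) (hz.memLp_apply j),
    hz.integral_apply i, zero_mul, sub_zero]
  rfl

variable {K : Type*} {e : K → Ω → ι → ℝ} {S : Matrix ι ι ℝ}

theorem covariance_apply_of_iIndepFun [DecidableEq K] (he : ∀ k, IsCenteredGaussian (e k) S P)
    (hind : iIndepFun e P) (k l : K) (i j : ι) :
    cov[fun ω => e k ω i, fun ω => e l ω j; P] = (Pi.single k (S i) : K → ι → ℝ) l j := by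
  have := (he k).hasGaussianLaw.isProbabilityMeasure
  rcases eq_or_ne l k with rfl | hlk
  · rw [Pi.single_eq_same, (he l).covariance_apply]
  · rw [Pi.single_eq_of_ne hlk, Pi.zero_apply]
    exact ((hind.indepFun hlk.symm).comp (measurable_pi_apply i)
      (measurable_pi_apply j)).covariance_eq_zero ((he k).memLp_apply i) ((he l).memLp_apply j)

theorem covariance_apply_dual_of_iIndepFun [Finite K] [DecidableEq K]
    (he : ∀ k, IsCenteredGaussian (e k) S P) (hind : iIndepFun e P) (k : K) (i : ι)
    (L : StrongDual ℝ (K → ι → ℝ)) :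
    cov[fun ω => e k ω i, fun ω => L fun l => e l ω; P] = L (Pi.single k (S i)) := by
  classical
  cases nonempty_fintype K
  have := (he k).hasGaussianLaw.isProbabilityMeasure
  let c (l : K) (j : ι) : ℝ := L (Pi.single l fun i => if j = i then 1 else 0)
  have hL (x : K → ι → ℝ) : L x = ∑ l, ∑ j, x l j * c l j := by
    conv_lhs => rw [← Finset.univ_sum_single x, map_sum]
    exact Finset.sum_congr rfl fun l _ =>
      ((L : (K → ι → ℝ) →ₗ[ℝ] ℝ) ∘ₗ LinearMap.single ℝ _ l).pi_apply_eq_sum_univ (x l)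
  have hmem (l : K) (j : ι) : MemLp (fun ω => e l ω j * c l j) 2 P :=
    ((he l).memLp_apply j).mul_const _
  simp only [hL fun l => e l _, hL (Pi.single k (S i))]
  rw [covariance_fun_sum_right (fun l => memLp_finsetSum _ fun j _ => hmem l j)
    ((he k).memLp_apply i)]
  refine Finset.sum_congr rfl fun l _ => ?_
  rw [covariance_fun_sum_right (hmem l) ((he k).memLp_apply i)]
  exact Finset.sum_congr rfl fun j _ => by
    rw [covariance_mul_const_right, covariance_apply_of_iIndepFun he hind]

variable [Fintype K] [DecidableEq ι] {ε : ℝ}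

theorem integrable_resolvent_mulVec_apply [IsFiniteMeasure P] {X : Ω → K → ι → ℝ}
    (hX : AEMeasurable X P) (hε : 0 < ε) (k : K) (i : ι) :
    Integrable (fun ω => (resolvent ε (X ω) *ᵥ X ω k) i) P :=
  integrable_comp_of_continuous_of_bounded hX
    ((continuous_apply i).comp (continuous_resolvent_mulVec hε k))
    (exists_abs_resolvent_mulVec_apply_le hε k i)

theorem integrable_resolventLineDeriv_apply [IsFiniteMeasure P] {X : Ω → K → ι → ℝ}
    (hX : AEMeasurable X P) (hε : 0 < ε) (k : K) (v : ι → ℝ) (i : ι) :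
    Integrable (fun ω => resolventLineDeriv ε (X ω) k v i) P :=
  integrable_comp_of_continuous_of_bounded hX
    ((continuous_apply i).comp (continuous_resolventLineDeriv hε k v))
    (exists_abs_resolventLineDeriv_apply_le hε k v i)

theorem integrable_mul_resolvent_mulVec_apply [IsFiniteMeasure P] {X : Ω → K → ι → ℝ}
    (hX : AEMeasurable X P) (hε : 0 < ε) {f : Ω → ℝ} (hf : Integrable f P) (k : K) (i : ι) :
    Integrable (fun ω => f ω * (resolvent ε (X ω) *ᵥ X ω k) i) P := by
  obtain ⟨C, hC⟩ := exists_abs_resolvent_mulVec_apply_le (K := K) hε k i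
  exact hf.mul_bdd (c := C) (integrable_resolvent_mulVec_apply hX hε k i).aestronglyMeasurable
    (ae_of_all _ fun ω => hC (X ω))

theorem integral_apply_mul_resolvent_mulVec (he : ∀ k, IsCenteredGaussian (e k) S P)
    (hind : iIndepFun e P) (hε : 0 < ε) (k : K) (i : ι) :
    ∫ ω, e k ω i * (resolvent ε (fun l => e l ω) *ᵥ e k ω) i ∂P =
      ∫ ω, resolventLineDeriv ε (fun l => e l ω) k (S i) i ∂P := by
  classical
  have := (he k).hasGaussianLaw.isProbabilityMeasure
  have hX := iIndepFun.hasGaussianLaw (fun l => (he l).hasGaussianLaw) hind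
  let L : StrongDual ℝ (K → ι → ℝ) :=
    (.proj i : StrongDual ℝ (ι → ℝ)).comp (.proj k)
  exact integral_dual_mul_eq_integral_lineDeriv (L := L) hX
    ((he k).integral_apply i) (covariance_apply_dual_of_iIndepFun he hind k i)
    (fun x => hasLineDerivAt_resolvent_mulVec_apply hε x k (S i) i)
    ((continuous_apply i).comp (continuous_resolvent_mulVec hε k)).measurable
    ((continuous_apply i).comp (continuous_resolventLineDeriv hε k (S i))).measurable
    (integrable_resolvent_mulVec_apply hX.aemeasurable hε k i)
    (integrable_mul_resolvent_mulVec_apply hX.aemeasurable hε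
      (((he k).memLp_apply i).integrable (by simp)) k i)
    (integrable_resolventLineDeriv_apply hX.aemeasurable hε k (S i) i)

theorem integrable_resolvent_apply [IsFiniteMeasure P] {X : Ω → K → ι → ℝ} (hX : AEMeasurable X P)
    (hε : 0 < ε) (i j : ι) : Integrable (fun ω => resolvent ε (X ω) i j) P :=
  integrable_comp_of_continuous_of_bounded hX ((continuous_resolvent hε).matrix_elem i j) <| by
    simpa using exists_abs_dotProduct_resolvent_le hε (Pi.single i 1) (Pi.single j 1)

theorem integrable_trace_resolvent_mul [IsFiniteMeasure P] {X : Ω → K → ι → ℝ}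
    (hX : AEMeasurable X P) (hε : 0 < ε) (S : Matrix ι ι ℝ) :
    Integrable (fun ω => (resolvent ε (X ω) * S).trace) P := by
  simp only [trace, diag_apply, mul_apply]
  exact integrable_finsetSum _ fun i _ => integrable_finsetSum _ fun j _ =>
    (integrable_resolvent_apply hX hε i j).mul_const _

theorem integral_trace_resolvent_mul_le [IsProbabilityMeasure P]
    (he : ∀ k, IsCenteredGaussian (e k) S P) (hind : iIndepFun e P) (hS : S.PosSemidef)
    (hε : 0 < ε) :
    (Fintype.card K - Fintype.card ι - 1 : ℝ) *
      ∫ ω, (resolvent ε (fun k => e k ω) * S).trace ∂P ≤ Fintype.card ι := by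
  have hX : AEMeasurable (fun ω k => e k ω) P :=
    aemeasurable_pi_lambda _ fun k => (he k).hasGaussianLaw.aemeasurable
  have hderiv (k : K) (i : ι) :=
    integrable_resolventLineDeriv_apply hX hε k (S i) i
  have hprod (k : K) (i : ι) := integrable_mul_resolvent_mulVec_apply hX hε
    (((he k).memLp_apply i).integrable (by simp)) k i
  rw [← integral_const_mul]
  calc _ ≤ ∫ ω, ∑ k, ∑ i, resolventLineDeriv ε (fun l => e l ω) k (S i) i ∂P :=
        integral_mono ((integrable_trace_resolvent_mul hX hε S).const_mul _)
          (integrable_finsetSum _ fun k _ => integrable_finsetSum _ fun i _ => hderiv k i)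
          fun ω => le_sum_resolventLineDeriv hε _ hS
    _ = ∑ k, ∑ i, ∫ ω, e k ω i * (resolvent ε (fun l => e l ω) *ᵥ e k ω) i ∂P := by
        rw [integral_sum_sum hderiv]
        exact Finset.sum_congr rfl fun k _ => Finset.sum_congr rfl fun i _ =>
          (integral_apply_mul_resolvent_mulVec he hind hε k i).symm
    _ = ∫ ω, ∑ k, leverage ε (fun l => e l ω) k ∂P :=
        (integral_sum_sum hprod).symm
    _ ≤ ∫ _, (Fintype.card ι : ℝ) ∂P :=
        integral_mono
          (integrable_finsetSum _ fun k _ => integrable_finsetSum _ fun i _ => hprod k i)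
          (integrable_const _) fun ω => sum_leverage_le_card hε _
    _ = Fintype.card ι := by simp

variable {z : Ω → ι → ℝ} {T : Matrix ι ι ℝ}

theorem integrable_apply_mul_apply_mul_resolvent (hz : IsCenteredGaussian z T P)
    {X : Ω → K → ι → ℝ} (hX : AEMeasurable X P) (hε : 0 < ε) (i j : ι) :
    Integrable (fun ω => z ω j * z ω i * resolvent ε (X ω) i j) P := by
  have := hz.hasGaussianLaw.isProbabilityMeasure
  obtain ⟨C, hC⟩ := exists_abs_dotProduct_resolvent_le (K := K) hε (Pi.single i 1) (Pi.single j 1)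
  exact ((hz.memLp_apply j).integrable_mul (hz.memLp_apply i)).mul_bdd (c := C)
    (integrable_resolvent_apply hX hε i j).aestronglyMeasurable
    (ae_of_all _ fun ω => by simpa using hC (X ω))

theorem integrable_dotProduct_resolvent (hz : IsCenteredGaussian z T P)
    {X : Ω → K → ι → ℝ} (hX : AEMeasurable X P) (hε : 0 < ε) :
    Integrable (fun ω => z ω ⬝ᵥ resolvent ε (X ω) *ᵥ z ω) P := by
  simp only [dotProduct_mulVec_eq_sum_sum]
  exact integrable_finsetSum _ fun i _ => integrable_finsetSum _ fun j _ =>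
    integrable_apply_mul_apply_mul_resolvent hz hX hε i j

theorem integral_dotProduct_resolvent (hz : IsCenteredGaussian z T P)
    {X : Ω → K → ι → ℝ} (hX : AEMeasurable X P) (hind : IndepFun z X P) (hε : 0 < ε) :
    ∫ ω, z ω ⬝ᵥ resolvent ε (X ω) *ᵥ z ω ∂P = ∫ ω, (resolvent ε (X ω) * T).trace ∂P := by
  have := hz.hasGaussianLaw.isProbabilityMeasure
  have hint := integrable_apply_mul_apply_mul_resolvent hz hX hε
  have hR (i j : ι) := integrable_resolvent_apply hX hε i j
  have hentry (i j : ι) : ∫ ω, z ω j * z ω i * resolvent ε (X ω) i j ∂P =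
      ∫ ω, resolvent ε (X ω) i j * T j i ∂P := by
    have hij : IndepFun (fun ω => z ω j * z ω i) (fun ω => resolvent ε (X ω) i j) P :=
      hind.comp (φ := fun a : ι → ℝ => a j * a i) (ψ := fun e => resolvent ε e i j) (by fun_prop)
        ((continuous_resolvent hε).matrix_elem i j).measurable
    rw [hij.integral_fun_mul_eq_mul_integral
      ((hz.memLp_apply j).integrable_mul (hz.memLp_apply i)).aestronglyMeasurable
      (hR i j).aestronglyMeasurable, hz.integral_apply_mul_apply, integral_mul_const, mul_comm]
  simp only [dotProduct_mulVec_eq_sum_sum, trace, diag_apply, mul_apply]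
  rw [integral_sum_sum hint, integral_sum_sum fun i j => (hR i j).mul_const _]
  exact Finset.sum_congr rfl fun i _ => Finset.sum_congr rfl fun j _ => hentry i j

theorem integral_dotProduct_resolvent_le (he : ∀ k, IsCenteredGaussian (e k) S P)
    (hind : iIndepFun e P) (hS : S.PosSemidef) (hz : IsCenteredGaussian z T P)
    (hze : IndepFun z (fun ω k => e k ω) P) (hTS : (S - T).PosSemidef)
    (hcard : Fintype.card ι + 1 < Fintype.card K) (hε : 0 < ε) :
    ∫ ω, z ω ⬝ᵥ resolvent ε (fun k => e k ω) *ᵥ z ω ∂P ≤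
      Fintype.card ι / (Fintype.card K - Fintype.card ι - 1) := by
  have := hz.hasGaussianLaw.isProbabilityMeasure
  have hX : AEMeasurable (fun ω k => e k ω) P :=
    aemeasurable_pi_lambda _ fun k => (he k).hasGaussianLaw.aemeasurable
  have hpos : 0 < (Fintype.card K - Fintype.card ι - 1 : ℝ) := by
    rw [sub_sub, sub_pos]
    exact_mod_cast hcard
  rw [le_div_iff₀' hpos]
  refine le_trans ?_ (integral_trace_resolvent_mul_le he hind hS hε)
  refine mul_le_mul_of_nonneg_left ?_ hpos.le
  rw [integral_dotProduct_resolvent hz hX hze hε]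
  refine integral_mono (integrable_trace_resolvent_mul hX hε _)
    (integrable_trace_resolvent_mul hX hε _) fun ω => ?_
  have htrace := trace_resolvent_nonneg hε (fun k => e k ω) hTS
  rwa [Matrix.mul_sub, trace_sub, sub_nonneg] at htrace

end ExpectationOfResolvent

section EllipsoidProbability
variable {ι K : Type*} [Fintype ι] [DecidableEq ι] [Fintype K]

theorem tendsto_resolvent {e : K → ι → ℝ} (he : (scatter e).det ≠ 0) :
    Tendsto (fun ε => resolvent ε e) (𝓝 0) (𝓝 (scatter e)⁻¹) := by
  have hreg : Tendsto (fun ε : ℝ => ε • (1 : Matrix ι ι ℝ) + scatter e) (𝓝 0) (𝓝 (scatter e)) :=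
    Continuous.tendsto' (by fun_prop) _ _ (by simp)
  refine (continuousAt_matrix_inv _ ?_).tendsto.comp hreg
  rw [Ring.inverse_eq_inv']
  exact continuousAt_inv₀ he

theorem ofReal_dotProduct_inv_scatter_le_liminf {s : ℕ → ℝ} (hs : Tendsto s atTop (𝓝 0))
    (e : K → ι → ℝ) (z : ι → ℝ) :
    ENNReal.ofReal (z ⬝ᵥ (scatter e)⁻¹ *ᵥ z) ≤
      liminf (fun j => ENNReal.ofReal (z ⬝ᵥ resolvent (s j) e *ᵥ z)) atTop := by
  by_cases he : (scatter e).det = 0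
  · -- The inverse of a singular matrix is `0`, so the left-hand side vanishes.
    simp [nonsing_inv_apply_not_isUnit (scatter e) (by simp [he])]
  · have hz : Continuous fun Q : Matrix ι ι ℝ => ENNReal.ofReal (z ⬝ᵥ Q *ᵥ z) :=
      ENNReal.continuous_ofReal.comp (by fun_prop)
    exact ((hz.tendsto _).comp ((tendsto_resolvent he).comp hs)).liminf_eq.ge

variable {Ω : Type*} [MeasurableSpace Ω] {P : Measure Ω} {e : K → Ω → ι → ℝ} {z : Ω → ι → ℝ}
  {S T : Matrix ι ι ℝ}

theorem lintegral_dotProduct_resolvent_le (he : ∀ k, IsCenteredGaussian (e k) S P)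
    (hind : iIndepFun e P) (hS : S.PosSemidef) (hz : IsCenteredGaussian z T P)
    (hze : IndepFun z (fun ω k => e k ω) P) (hTS : (S - T).PosSemidef)
    (hcard : Fintype.card ι + 1 < Fintype.card K) {ε : ℝ} (hε : 0 < ε) :
    ∫⁻ ω, ENNReal.ofReal (z ω ⬝ᵥ resolvent ε (fun k => e k ω) *ᵥ z ω) ∂P ≤
      ENNReal.ofReal (Fintype.card ι / (Fintype.card K - Fintype.card ι - 1)) := by
  have hX : AEMeasurable (fun ω k => e k ω) P :=
    aemeasurable_pi_lambda _ fun k => (he k).hasGaussianLaw.aemeasurable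
  rw [← ofReal_integral_eq_lintegral_ofReal (integrable_dotProduct_resolvent hz hX hε)
    (ae_of_all _ fun ω => dotProduct_resolvent_nonneg hε _ _)]
  exact ENNReal.ofReal_le_ofReal
    (integral_dotProduct_resolvent_le he hind hS hz hze hTS hcard hε)

theorem measure_lt_dotProduct_inv_scatter_le (he : ∀ k, IsCenteredGaussian (e k) S P)
    (hind : iIndepFun e P) (hS : S.PosSemidef) (hz : IsCenteredGaussian z T P)
    (hze : IndepFun z (fun ω k => e k ω) P) (hTS : (S - T).PosSemidef)
    (hcard : Fintype.card ι + 1 < Fintype.card K) {r : ℝ} (hr : 0 < r) :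
    P {ω | r < z ω ⬝ᵥ (scatter fun k => e k ω)⁻¹ *ᵥ z ω} ≤
      ENNReal.ofReal (Fintype.card ι / (Fintype.card K - Fintype.card ι - 1) / r) := by
  let s (j : ℕ) : ℝ := 1 / (j + 1)
  have hs : Tendsto s atTop (𝓝 0) := tendsto_one_div_add_atTop_nhds_zero_nat
  have hX : AEMeasurable (fun ω k => e k ω) P :=
    aemeasurable_pi_lambda _ fun k => (he k).hasGaussianLaw.aemeasurable
  let q (j : ℕ) (ω : Ω) := ENNReal.ofReal (z ω ⬝ᵥ resolvent (s j) (fun k => e k ω) *ᵥ z ω)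
  have hq (j : ℕ) : AEMeasurable (q j) P :=
    (integrable_dotProduct_resolvent hz hX Nat.one_div_pos_of_nat).aemeasurable.ennreal_ofReal
  have hliminf : AEMeasurable (fun ω => liminf (fun j => q j ω) atTop) P := by
    simp only [liminf_eq_iSup_iInf_of_nat]
    exact .iSup fun i => .biInf _ (Set.to_countable _) fun j _ => hq j
  calc P {ω | r < z ω ⬝ᵥ (scatter fun k => e k ω)⁻¹ *ᵥ z ω}
      ≤ P {ω | ENNReal.ofReal r ≤ liminf (fun j => q j ω) atTop} :=
        measure_mono fun ω hω => (ENNReal.ofReal_le_ofReal (le_of_lt hω)).trans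
          (ofReal_dotProduct_inv_scatter_le_liminf hs _ _)
    _ ≤ (∫⁻ ω, liminf (fun j => q j ω) atTop ∂P) / ENNReal.ofReal r :=
        meas_ge_le_lintegral_div hliminf (by simpa using hr) (by simp)
    _ ≤ ENNReal.ofReal (Fintype.card ι / (Fintype.card K - Fintype.card ι - 1)) /
          ENNReal.ofReal r := by
        gcongr
        exact (lintegral_liminf_le' hq).trans <| liminf_le_of_frequently_le' <|
          .of_forall fun j => lintegral_dotProduct_resolvent_le he hind hS hz hze hTS hcard
            Nat.one_div_pos_of_nat
    _ = _ := (ENNReal.ofReal_div_of_pos hr).symm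

end EllipsoidProbability

section CenteredGaussian
variable {Ω : Type*} [MeasurableSpace Ω] {P : Measure Ω} {ι : Type*} [Fintype ι]
  {X Y : Ω → ι → ℝ} {S T : Matrix ι ι ℝ}

theorem isCenteredGaussian_of_hasLaw_toLp [DecidableEq ι] (hS : S.PosSemidef)
    (hX : HasLaw (fun ω => WithLp.toLp 2 (X ω)) (multivariateGaussian 0 S) P) :
    IsCenteredGaussian X S P where
  hasGaussianLaw := hX.hasGaussianLaw.map_equiv (EuclideanSpace.equiv ι ℝ)
  integral_apply i := by
    have hproj := (EuclideanSpace.proj i : StrongDual ℝ (EuclideanSpace ℝ ι)).integral_comp_comm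
      hX.hasGaussianLaw.integrable
    rw [hX.integral_eq, integral_id_multivariateGaussian, map_zero] at hproj
    exact hproj
  covariance_apply i j := by
    rw [← covariance_eval_multivariateGaussian hS i j]
    exact (hX.covariance_comp (f := fun x => x i) (g := fun x => x j) (by fun_prop) (by fun_prop))

theorem IsCenteredGaussian.mulVec {κ : Type*} [Fintype κ] (hX : IsCenteredGaussian X S P)
    (A : Matrix κ ι ℝ) : IsCenteredGaussian (fun ω => A *ᵥ X ω) (A * S * Aᵀ) P where
  hasGaussianLaw := hX.hasGaussianLaw.map (LinearMap.toContinuousLinearMap A.mulVecLin)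
  integral_apply i := by
    have := hX.hasGaussianLaw.isProbabilityMeasure
    simp only [Matrix.mulVec, dotProduct]
    rw [integral_finsetSum _ fun j _ => ((hX.memLp_apply j).integrable (by simp)).const_mul _]
    simp [integral_const_mul, hX.integral_apply]
  covariance_apply i j := by
    have := hX.hasGaussianLaw.isProbabilityMeasure
    simp only [Matrix.mulVec, dotProduct]
    rw [covariance_fun_sum_fun_sum (fun k => (hX.memLp_apply k).const_mul _)
      fun k => (hX.memLp_apply k).const_mul _]
    simp only [covariance_const_mul_left, covariance_const_mul_right, hX.covariance_apply,
      mul_apply, transpose_apply, Finset.sum_mul]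
    rw [Finset.sum_comm]
    exact Finset.sum_congr rfl fun k _ => Finset.sum_congr rfl fun l _ => by ring

theorem IsCenteredGaussian.add (hX : IsCenteredGaussian X S P) (hY : IsCenteredGaussian Y T P)
    (hXY : IndepFun X Y P) : IsCenteredGaussian (fun ω => X ω + Y ω) (S + T) P where
  hasGaussianLaw := (hXY.hasGaussianLaw hX.hasGaussianLaw hY.hasGaussianLaw).fun_add
  integral_apply i := by
    have := hX.hasGaussianLaw.isProbabilityMeasure
    simp only [Pi.add_apply]
    rw [integral_add ((hX.memLp_apply i).integrable (by simp))
      ((hY.memLp_apply i).integrable (by simp)), hX.integral_apply, hY.integral_apply, add_zero]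
  covariance_apply i j := by
    have := hX.hasGaussianLaw.isProbabilityMeasure
    have hcov (i j : ι) : cov[fun ω => X ω i, fun ω => Y ω j; P] = 0 :=
      (hXY.comp (measurable_pi_apply i) (measurable_pi_apply j)).covariance_eq_zero
        (hX.memLp_apply i) (hY.memLp_apply j)
    change cov[(fun ω => X ω i) + (fun ω => Y ω i), (fun ω => X ω j) + (fun ω => Y ω j); P] = _
    rw [covariance_add_left (hX.memLp_apply i) (hY.memLp_apply i)
        ((hX.memLp_apply j).add (hY.memLp_apply j)),
      covariance_add_right (hX.memLp_apply i) (hX.memLp_apply j) (hY.memLp_apply j),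
      covariance_add_right (hY.memLp_apply i) (hX.memLp_apply j) (hY.memLp_apply j), hcov,
      covariance_comm (fun ω => Y ω i), hcov, hX.covariance_apply, hY.covariance_apply, add_zero,
      zero_add, Matrix.add_apply]

end CenteredGaussian

section Independence
variable {Ω E I J : Type*} [MeasurableSpace Ω] [MeasurableSpace E] {P : Measure Ω}

theorem iIndepFun_curry [Countable I] [Countable J] {X : I → J → Ω → E}
    (hX : iIndepFun (fun ij : I × J => X ij.1 ij.2) P) (hm : ∀ i j, AEMeasurable (X i j) P) :
    iIndepFun (fun i ω j => X i j ω) P := by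
  have := hX.isProbabilityMeasure
  have hrow (i : I) : P.map (fun ω j => X i j ω) = Measure.infinitePi fun j => P.map (X i j) :=
    (hX.precomp (g := fun j => (i, j)) (Prod.mk_right_injective i)).map_fun_eq_infinitePi_map₀'
      (hm i)
  have (i : I) (j : J) : IsProbabilityMeasure (P.map (X i j)) :=
    Measure.isProbabilityMeasure_map (hm i j)
  rw [iIndepFun_iff_map_fun_eq_infinitePi_map₀' fun i => aemeasurable_pi_lambda _ (hm i)]
  simp only [hrow]
  have hall := hX.map_fun_eq_infinitePi_map₀' fun ij : I × J => hm ij.1 ij.2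
  rw [← Measure.infinitePi_map_curry (fun i j => P.map (X i j)), ← hall,
    AEMeasurable.map_map_of_aemeasurable (MeasurableEquiv.measurable _).aemeasurable
      (aemeasurable_pi_lambda _ fun ij : I × J => hm ij.1 ij.2)]
  rfl

theorem indepFun_option_none_some [Finite I] {X : Option I → Ω → E} (hX : iIndepFun X P)
    (hm : ∀ i, AEMeasurable (X i) P) : IndepFun (X none) (fun ω i => X (some i) ω) P := by
  classical
  cases nonempty_fintype I
  exact (hX.indepFun_finset₀ {none} (Finset.univ.map .some) (by simp) hm).comp
    (φ := fun x : ({none} : Finset (Option I)) → E => x ⟨none, by simp⟩)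
    (ψ := fun (x : (Finset.univ.map .some : Finset (Option I)) → E) i => x ⟨some i, by simp⟩)
    (by fun_prop) (by fun_prop)

end Independence

section Noise
variable {Ω E : Type*} [MeasurableSpace Ω] [MeasurableSpace E] {P : Measure Ω}

-- The two conditions on `τ` make the noises `w (τ i)`, `v (τ i)`, `v (τ i + 1)` pairwise distinct.
theorem iIndepFun_vec_of_injective {w v : ℕ → Ω → E} (hindep : iIndepFun (Sum.elim w v) P)
    (hw : ∀ k, AEMeasurable (w k) P) (hv : ∀ k, AEMeasurable (v k) P) {κ : Type*} [Countable κ]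
    {τ : κ → ℕ} (hτ : τ.Injective) (hτ' : ∀ i j, τ i ≠ τ j + 1) :
    iIndepFun (fun i ω => ![w (τ i) ω, v (τ i) ω, v (τ i + 1) ω]) P := by
  let g (ij : κ × Fin 3) : ℕ ⊕ ℕ := ![.inl (τ ij.1), .inr (τ ij.1), .inr (τ ij.1 + 1)] ij.2
  have hg : g.Injective := by
    rintro ⟨i, a⟩ ⟨j, b⟩ h
    have hji : τ i + 1 ≠ τ j := (hτ' j i).symm
    fin_cases a <;> fin_cases b <;> simp_all [g, hτ.eq_iff]
  have hm (s : ℕ ⊕ ℕ) : AEMeasurable (Sum.elim w v s) P := s.rec hw hv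
  convert! iIndepFun_curry (X := fun i j => Sum.elim w v (g (i, j))) (hindep.precomp hg)
    (fun i j => hm _) using 3 with i ω
  ext j
  fin_cases j <;> rfl

end Noise

section Prediction
variable {Ω ι : Type*} [Fintype ι] {w v : ℕ → Ω → ι → ℝ}

/-- The error `x_{k+1} - (A y_k + B u_k)` of the one-step prediction of the state, written in terms
of the process noise `w` and the measurement noise `v`. -/
def predictionError (A : Matrix ι ι ℝ) (w v : ℕ → Ω → ι → ℝ) (k : ℕ) (ω : Ω) : ι → ℝ :=
  w k ω - A *ᵥ v k ω

/-- The innovation `y_{k+1} - (A y_k + B u_k)`, written in terms of the process noise `w` and the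
measurement noise `v`. -/
def innovation (A : Matrix ι ι ℝ) (w v : ℕ → Ω → ι → ℝ) (k : ℕ) (ω : Ω) : ι → ℝ :=
  predictionError A w v k ω + v (k + 1) ω

variable [MeasurableSpace Ω] {P : Measure Ω} {A Sw Sv : Matrix ι ι ℝ}

theorem isCenteredGaussian_predictionError (hindep : iIndepFun (Sum.elim w v) P) {k : ℕ}
    (hw : IsCenteredGaussian (w k) Sw P) (hv : IsCenteredGaussian (v k) Sv P) :
    IsCenteredGaussian (predictionError A w v k) (Sw + A * Sv * Aᵀ) P := by
  have hwv : IndepFun (w k) (v k) P := hindep.indepFun (i := .inl k) (j := .inr k) (by simp)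
  simpa [predictionError, sub_eq_add_neg, neg_mulVec] using!
    hw.add (hv.mulVec (-A)) (hwv.comp (ψ := fun x => -A *ᵥ x) measurable_id (by fun_prop))

theorem isCenteredGaussian_innovation (hindep : iIndepFun (Sum.elim w v) P)
    (hw : ∀ k, IsCenteredGaussian (w k) Sw P) (hv : ∀ k, IsCenteredGaussian (v k) Sv P) (k : ℕ) :
    IsCenteredGaussian (innovation A w v k) (Sw + A * Sv * Aᵀ + Sv) P := by
  have hm (s : ℕ ⊕ ℕ) : AEMeasurable (Sum.elim w v s) P :=
    s.rec (fun k => (hw k).hasGaussianLaw.aemeasurable)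
      fun k => (hv k).hasGaussianLaw.aemeasurable
  have hpair : IndepFun (fun ω => (w k ω, v k ω)) (v (k + 1)) P :=
    hindep.indepFun_prodMk₀ hm (.inl k) (.inr k) (.inr (k + 1)) (by simp) (by simp)
  exact (isCenteredGaussian_predictionError hindep (hw k) (hv k)).add (hv (k + 1))
    (hpair.comp (φ := fun x : (ι → ℝ) × (ι → ℝ) => x.1 - A *ᵥ x.2) (by fun_prop) measurable_id)

theorem iIndepFun_predictionError_innovation (hindep : iIndepFun (Sum.elim w v) P)
    (hw : ∀ k, AEMeasurable (w k) P) (hv : ∀ k, AEMeasurable (v k) P) {κ : Type*} [Countable κ]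
    {τ : κ → ℕ} (hτ : τ.Injective) (hτ' : ∀ i j, τ i ≠ τ j + 1) :
    iIndepFun (fun i ω => (predictionError A w v (τ i) ω, innovation A w v (τ i) ω)) P :=
  (iIndepFun_vec_of_injective hindep hw hv hτ hτ').comp
    (fun _ x => (x 0 - A *ᵥ x 1, x 0 - A *ᵥ x 1 + x 2)) fun _ => by fun_prop

end Prediction

section PredictionErrorBound
variable {Ω ι κ : Type*} [MeasurableSpace Ω] {P : Measure Ω} [Fintype ι] [DecidableEq ι]
  [Fintype κ] {w v : ℕ → Ω → ι → ℝ} {Sw Sv : Matrix ι ι ℝ}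

theorem measure_lt_predictionError_le (A : Matrix ι ι ℝ) (hSw : Sw.PosSemidef)
    (hSv : Sv.PosSemidef) (hindep : iIndepFun (Sum.elim w v) P)
    (hw : ∀ k, IsCenteredGaussian (w k) Sw P) (hv : ∀ k, IsCenteredGaussian (v k) Sv P)
    (hcard : Fintype.card ι + 1 < Fintype.card κ) {τ : Option κ → ℕ} (hτ : τ.Injective)
    (hτ' : ∀ i j, τ i ≠ τ j + 1) {r : ℝ} (hr : 0 < r) :
    P {ω | r < predictionError A w v (τ none) ω ⬝ᵥ
        (scatter fun k => innovation A w v (τ (some k)) ω)⁻¹ *ᵥ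
          predictionError A w v (τ none) ω} ≤
      ENNReal.ofReal (Fintype.card ι / (Fintype.card κ - Fintype.card ι - 1) / r) := by
  have hT : (Sw + A * Sv * Aᵀ).PosSemidef := hSw.add (hSv.mul_mul_conjTranspose_same A)
  have hz (k : ℕ) := isCenteredGaussian_predictionError (A := A) hindep (hw k) (hv k)
  have he (k : ℕ) := isCenteredGaussian_innovation (A := A) hindep hw hv k
  have hpair := iIndepFun_predictionError_innovation (A := A) hindep
    (fun k => (hw k).hasGaussianLaw.aemeasurable) (fun k => (hv k).hasGaussianLaw.aemeasurable)
    hτ hτ'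
  have hind : iIndepFun (fun k => innovation A w v (τ (some k))) P :=
    (hpair.precomp (Option.some_injective κ)).comp (fun _ => Prod.snd) fun _ => measurable_snd
  have hze : IndepFun (predictionError A w v (τ none))
      (fun ω k => innovation A w v (τ (some k)) ω) P :=
    (indepFun_option_none_some hpair fun i => (hz _).hasGaussianLaw.aemeasurable.prodMk
      (he _).hasGaussianLaw.aemeasurable).comp
      (ψ := fun (x : κ → (ι → ℝ) × (ι → ℝ)) k => (x k).2) measurable_fst (by fun_prop)
  exact measure_lt_dotProduct_inv_scatter_le (fun k => he _) hind (hT.add hSv) (hz _) hze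
    (by simpa using hSv) hcard hr

end PredictionErrorBound

theorem inv_smul_of_ne_zero {ι R : Type*} [Fintype ι] [DecidableEq ι] [Field R] {c : R}
    (hc : c ≠ 0) (M : Matrix ι ι R) : (c • M)⁻¹ = c⁻¹ • M⁻¹ := by
  by_cases hM : IsUnit M.det
  · exact inv_smul' M (Units.mk0 c hc) hM
  · rw [nonsing_inv_apply_not_isUnit _ hM, smul_zero, nonsing_inv_apply_not_isUnit]
    rwa [det_smul, isUnit_iff_ne_zero, mul_ne_zero_iff_left (pow_ne_zero _ hc),
      ← isUnit_iff_ne_zero]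

section EllipsoidBound
variable {n m : ℕ}

theorem empiricalCov_eq_smul_scatter (A : Matrix (Fin n) (Fin n) ℝ) (B : Matrix (Fin n) (Fin m) ℝ)
    (y : ℕ → Fin n → ℝ) (u : ℕ → Fin m → ℝ) (t : ℕ) :
    empiricalCov A B y u t = ((t / 2 : ℕ) : ℝ)⁻¹ •
      scatter fun k : Fin (t / 2) => y (2 * k + 1) - (A *ᵥ y (2 * k) + B *ᵥ u (2 * k)) := by
  rw [empiricalCov, Finset.sum_range]
  rfl

theorem measureReal_ellipsoidBound_lt_le {Ω : Type*} [MeasurableSpace Ω] {P : Measure Ω}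
    {w v : ℕ → Ω → Fin n → ℝ} (A : Matrix (Fin n) (Fin n) ℝ) {Sw Sv : Matrix (Fin n) (Fin n) ℝ}
    (hSw : Sw.PosSemidef) (hSv : Sv.PosSemidef) (hindep : iIndepFun (Sum.elim w v) P)
    (hw : ∀ k, IsCenteredGaussian (w k) Sw P) (hv : ∀ k, IsCenteredGaussian (v k) Sv P)
    {δ : ℝ} (hδ : 0 < δ) {t : ℕ} (ht : 2 * n + 3 < t) :
    P.real {ω | ellipsoidBound n t δ < predictionError A w v t ω ⬝ᵥ
      (((t / 2 : ℕ) : ℝ)⁻¹ • scatter fun k : Fin (t / 2) => innovation A w v (2 * k) ω)⁻¹ *ᵥ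
        predictionError A w v t ω} ≤ δ := by
  rcases Nat.eq_zero_or_pos n with rfl | hn
  · simpa [ellipsoidBound] using hδ.le
  have hN : n + 1 < t / 2 := by omega
  have hN₀ : (0 : ℝ) < (t / 2 : ℕ) := by exact_mod_cast (Nat.zero_lt_of_lt hN)
  have hgap : (0 : ℝ) < (t / 2 : ℕ) - n - 1 := by
    rw [sub_sub, sub_pos]
    exact_mod_cast hN
  let τ (i : Option (Fin (t / 2))) : ℕ := i.elim t fun k => 2 * k
  have hτ : τ.Injective := by
    rintro (_ | i) (_ | j) h <;> simp [τ, Fin.ext_iff] at h ⊢ <;> omega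
  have hτ' (i j) : τ i ≠ τ j + 1 := by
    rcases i with _ | i <;> rcases j with _ | j <;> simp [τ] <;> omega
  have hr : 0 < n / (((t / 2 : ℕ) - n - 1) * δ) :=
    div_pos (Nat.cast_pos.2 hn) (mul_pos hgap hδ)
  have hmarkov :=
    measure_lt_predictionError_le A hSw hSv hindep hw hv (by simpa using hN) hτ hτ' hr
  refine ENNReal.toReal_le_of_le_ofReal hδ.le ?_
  convert! hmarkov using 2
  · ext ω
    simp only [Set.mem_ofPred_eq]
    rw [inv_smul_of_ne_zero (inv_ne_zero hN₀.ne'), inv_inv, smul_mulVec, dotProduct_smul,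
      smul_eq_mul, ellipsoidBound, mul_div_assoc, mul_lt_mul_iff_right₀ hN₀]
    rfl
  · simp only [Fintype.card_fin]
    field_simp

end EllipsoidBound

section Dynamics
variable {Ω : Type*} {n m : ℕ} {A : Matrix (Fin n) (Fin n) ℝ} {B : Matrix (Fin n) (Fin m) ℝ}
  {w v x y : ℕ → Ω → Fin n → ℝ} {u : ℕ → Ω → Fin m → ℝ}

theorem state_succ_eq (hx : ∀ k ω, x (k + 1) ω = A *ᵥ x k ω + B *ᵥ u k ω + w k ω)
    (hy : ∀ k ω, y k ω = x k ω + v k ω) (k : ℕ) (ω : Ω) :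
    x (k + 1) ω = A *ᵥ y k ω + B *ᵥ u k ω + predictionError A w v k ω := by
  rw [hx, hy, predictionError, mulVec_add]
  abel

theorem measurement_sub_prediction_eq
    (hx : ∀ k ω, x (k + 1) ω = A *ᵥ x k ω + B *ᵥ u k ω + w k ω)
    (hy : ∀ k ω, y k ω = x k ω + v k ω) (k : ℕ) (ω : Ω) :
    y (k + 1) ω - (A *ᵥ y k ω + B *ᵥ u k ω) = innovation A w v k ω := by
  rw [hy (k + 1), state_succ_eq hx hy, innovation]
  abel

end Dynamics

theorem one_sub_le_measureReal_of_ae {Ω : Type*} [MeasurableSpace Ω] {P : Measure Ω}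
    [IsProbabilityMeasure P] {bad good : Set Ω} {δ : ℝ} (hbad : P.real bad ≤ δ)
    (hgood : ∀ᵐ ω ∂P, ω ∉ bad → ω ∈ good) : 1 - δ ≤ P.real good := by
  have hcover : P.real Set.univ ≤ P.real (bad ∪ good) :=
    ENNReal.toReal_mono (measure_ne_top _ _) <| measure_mono_ae <| by
      filter_upwards [hgood] with ω hω _ using or_iff_not_imp_left.2 hω
  rw [probReal_univ] at hcover
  linarith [measureReal_union_le (μ := P) bad good]

end NoisySafeLearning

theorem theorem5_general {Ω : Type*} [MeasurableSpace Ω] (P : MeasureTheory.Measure Ω)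
    [MeasureTheory.IsProbabilityMeasure P] {n m p : ℕ}
    (A : Matrix (Fin n) (Fin n) ℝ) (B : Matrix (Fin n) (Fin m) ℝ)
    (Sw Sv : Matrix (Fin n) (Fin n) ℝ) (hSw : Sw.PosSemidef) (hSv : Sv.PosSemidef)
    (w v : ℕ → Ω → Fin n → ℝ)
    (hw : ∀ k, ProbabilityTheory.HasLaw (fun ω => WithLp.toLp 2 (w k ω))
      (ProbabilityTheory.multivariateGaussian 0 Sw) P)
    (hv : ∀ k, ProbabilityTheory.HasLaw (fun ω => WithLp.toLp 2 (v k ω))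
      (ProbabilityTheory.multivariateGaussian 0 Sv) P)
    (hindep : ProbabilityTheory.iIndepFun (Sum.elim w v) P)
    (x y : ℕ → Ω → Fin n → ℝ) (u : ℕ → Ω → Fin m → ℝ)
    (hx : ∀ k ω, x (k + 1) ω = A *ᵥ x k ω + B *ᵥ u k ω + w k ω)
    (hy : ∀ k ω, y k ω = x k ω + v k ω)
    (H : ℕ → Matrix (Fin p) (Fin n) ℝ) (h : ℕ → Fin p → ℝ)
    (δ : ℝ) (hδ : 0 < δ) (t : ℕ) (ht : 2 * n + 3 < t) (F : Ω → Set (Fin m → ℝ))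
    (hF : ∀ ω, F ω = NoisySafeLearning.feasibleSet A B (H (t + 1)) (h (t + 1)) (y t ω)
      (NoisySafeLearning.empiricalCov A B (fun k => y k ω) (fun k => u k ω) t)
      (NoisySafeLearning.ellipsoidBound n t δ))
    (hu : ∀ᵐ ω ∂P, (F ω).Nonempty → u t ω ∈ F ω) :
    ((∀ᵐ ω ∂P, (F ω).Nonempty) →
      1 - δ ≤ P.real {ω | H (t + 1) *ᵥ x (t + 1) ω ≤ h (t + 1)}) ∧
    1 - δ ≤ P.real {ω | (F ω).Nonempty → H (t + 1) *ᵥ x (t + 1) ω ≤ h (t + 1)} := by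
  open NoisySafeLearning in
  have hbad := measureReal_ellipsoidBound_lt_le A hSw hSv hindep
    (fun k => isCenteredGaussian_of_hasLaw_toLp hSw (hw k))
    (fun k => isCenteredGaussian_of_hasLaw_toLp hSv (hv k)) hδ ht
  have hsafe : ∀ᵐ ω ∂P, ω ∉ {ω | ellipsoidBound n t δ < predictionError A w v t ω ⬝ᵥ
      (((t / 2 : ℕ) : ℝ)⁻¹ • scatter fun k : Fin (t / 2) => innovation A w v (2 * k) ω)⁻¹ *ᵥ
        predictionError A w v t ω} →
      (F ω).Nonempty → H (t + 1) *ᵥ x (t + 1) ω ≤ h (t + 1) := by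
    filter_upwards [hu] with ω hmem hgood hne
    have hrobust := hmem hne
    simp only [hF, empiricalCov_eq_smul_scatter, measurement_sub_prediction_eq hx hy] at hrobust
    rw [state_succ_eq hx hy]
    exact hrobust _ (not_lt.1 hgood)
  refine ⟨fun hfeas => one_sub_le_measureReal_of_ae hbad ?_,
    one_sub_le_measureReal_of_ae hbad hsafe⟩
  filter_upwards [hsafe, hfeas] with ω hω hne hgood using hω hgood hne

theorem theorem5 {Ω : Type*} [MeasurableSpace Ω] (P : MeasureTheory.Measure Ω)
    [MeasureTheory.IsProbabilityMeasure P]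
    {n m p : ℕ}
    -- linear dynamics and covariances of the process and measurement noise
    (A : Matrix (Fin n) (Fin n) ℝ) (B : Matrix (Fin n) (Fin m) ℝ)
    (Sw Sv : Matrix (Fin n) (Fin n) ℝ) (hSw : Sw.PosSemidef) (hSv : Sv.PosSemidef)
    -- process noise `w` and measurement noise `v`: Gaussian, all mutually independent
    (w v : ℕ → Ω → Fin n → ℝ)
    (hw : ∀ k, ProbabilityTheory.HasLaw (fun ω => WithLp.toLp 2 (w k ω))
      (ProbabilityTheory.multivariateGaussian 0 Sw) P)
    (hv : ∀ k, ProbabilityTheory.HasLaw (fun ω => WithLp.toLp 2 (v k ω))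
      (ProbabilityTheory.multivariateGaussian 0 Sv) P)
    (hindep : ProbabilityTheory.iIndepFun (Sum.elim w v) P)
    -- states `x`, measurements `y`, inputs `u`
    (x y : ℕ → Ω → Fin n → ℝ) (u : ℕ → Ω → Fin m → ℝ)
    (hx : ∀ k ω, x (k + 1) ω = A *ᵥ x k ω + B *ᵥ u k ω + w k ω)
    (hy : ∀ k ω, y k ω = x k ω + v k ω)
    -- safety constraints `H k *ᵥ x k ≤ h k`
    (H : ℕ → Matrix (Fin p) (Fin n) ℝ) (h : ℕ → Fin p → ℝ)
    -- objective `d(·, ubar)` of the robust program, with nominal inputs `ubar`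
    (d : (Fin m → ℝ) → (Fin m → ℝ) → ℝ) (ubar : ℕ → Ω → Fin m → ℝ)
    (δ : ℝ) (hδ : 0 < δ) (t : ℕ) (ht : 2 * n + 3 < t)
    -- feasible set at time `t` of the robust program
    (F : Ω → Set (Fin m → ℝ))
    (hF : ∀ ω, F ω = NoisySafeLearning.feasibleSet A B (H (t + 1)) (h (t + 1)) (y t ω)
      (NoisySafeLearning.empiricalCov A B (fun k => y k ω) (fun k => u k ω) t)
      (NoisySafeLearning.ellipsoidBound n t δ))
    -- whenever the program is feasible, the implemented input `u t` is a solution of it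
    (hu : ∀ᵐ ω ∂P, (F ω).Nonempty → NoisySafeLearning.IsArgmin d (ubar t ω) (F ω) (u t ω)) :
    ((∀ᵐ ω ∂P, (F ω).Nonempty) →
      1 - δ ≤ P.real {ω | H (t + 1) *ᵥ x (t + 1) ω ≤ h (t + 1)}) ∧
    1 - δ ≤ P.real {ω | (F ω).Nonempty → H (t + 1) *ᵥ x (t + 1) ω ≤ h (t + 1)} :=
  theorem5_general P A B Sw Sv hSw hSv w v hw hv hindep x y u hx hy H h δ hδ t ht F hF
    (hu.mono fun _ hmin hne => (hmin hne).1)
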